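/- Let $\mathcal G$ be an acyclic directed mixed graph (ADMG) on a finite set $\boldsymbol V$ of observed variables and let $X,Y\in\boldsymbol V$. Write $\mathrm{An}_{\mathcal G}(\boldsymbol A)$ and $\mathrm{De}_{\mathcal G}(\boldsymbol A)$ for the ancestors and descendants of $\boldsymbol A$ (including $\boldsymbol A$), $\mathrm{Nb}^{\leftrightarrow}_{\mathcal G}(\boldsymbol A)$ for the nodes outside $\boldsymbol A$ joined to a node of $\boldsymbol A$ by a bidirected arc, $\mathcal G(\boldsymbol W)$ for the induced subgraph on $\boldsymbol W$, $\mathcal G_{\overline{\boldsymbol A}}$ for $\mathcal G$ without the arcs incoming to $\boldsymbol A$ (bidirected arcs at $\boldsymbol A$ included), $\mathcal G_{\underline{\boldsymbol A}}$ for $\mathcal G$ without the directed arcs outgoing from $\boldsymbol A$, and $\perp_m$ for m-separation. A triple $(\boldsymbol X^*,\boldsymbol Y^*,\boldsymbol M^*)$ is an FDR (front-door reducibility) triple of $\mathcal G$ relative to $(X,Y)$ if $\boldsymbol Y^*=\{Y\}$; $X\in\boldsymbol X^*\subseteq\{X\}\cup(\mathrm{An}_{\mathcal G}(\boldsymbol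 Y^*)\setminus\boldsymbol Y^*)$; and $\boldsymbol M^*$ is a non-empty subset of $$\bigl(\mathrm{An}_{\mathcal G}(\boldsymbol Y^*)\cap\mathrm{De}_{\mathcal G}(\boldsymbol X^*)\bigr)\setminus\bigl(\mathrm{Nb}^{\leftrightarrow}_{\mathcal G}(\boldsymbol X^*)\cup\mathrm{Nb}^{\leftrightarrow}_{\mathcal G}(\boldsymbol Y^*)\cup\boldsymbol X^*\cup\boldsymbol Y^*\bigr)$$ such that (FDR1) $\boldsymbol Y^*\cap\mathrm{De}_{\mathcal G(\boldsymbol V\setminus\boldsymbol M^*)}(\boldsymbol X^*)=\emptyset$; (FDR2) $(\boldsymbol X^*\perp_m\boldsymbol M^*)$ in $\mathcal G_{\underline{\boldsymbol X^*}}$; (FDR3) for every $M_i\in\boldsymbol M^*$, $(\boldsymbol Y^*\perp_m M_i\mid\boldsymbol X^*\cup(\boldsymbol M^*\setminus\{M_i\}))$ in $\mathcal G_{\overline{\boldsymbol X^*}\,\underline{M_i}}$. Let $(\boldsymbol X^*,\boldsymbol Y^*,\boldsymbol M^*)$ be an FDR triple. Consider any semi-Markovian structural causal model compatible with $\mathcal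 G$: each variable is a measurable function of its parents and of its own error variable, and the errors of two disjoint sets of nodes with no bidirected arc between them are independent. The variables take values in measurable spaces with countably generated $\sigma$-algebras, each carrying a $\sigma$-finite reference measure (for example Lebesgue or counting measure); reference measures on tuples are the products. Assume that the observational distribution of $(\boldsymbol Y^*,\boldsymbol X^*,\boldsymbol M^*)$ has a density $p$ with respect to the reference measure, and that for almost all $(\boldsymbol x^*,\boldsymbol m^*)$, $p(\boldsymbol x^*)>0$ and $p(\boldsymbol m^*)>0$ imply $p(\boldsymbol x^*,\boldsymbol m^*)>0$. Then, for almost every $\boldsymbol x^*$ with respect to the observational distribution of $\boldsymbol X^*$, the interventional distribution of $\boldsymbol Y^*$ under $do(\boldsymbol X^*=\boldsymbol x^*)$ has the density given by the FDR adjustment formula $$p(\boldsymbol y^*\mid do(\boldsymbol x^*))=\int p(\boldsymbol y^*\mid\boldsymbol x'^*,\boldsymbol m^*)\,p(\boldsymbol m^*\mid\boldsymbol x^*)\,p(\boldsymbol x'^*)\,d\boldsymbol m^*\,d\boldsymbol x'^*.$$ -/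

import Mathlib

open MeasureTheory ProbabilityTheory
open scoped ENNReal

/-- An acyclic directed mixed graph: directed arcs `u → v`, bidirected arcs `u ↔ v` (both may join
the same two nodes), no directed cycle. -/
structure ADMG (V : Type*) where
  dir : V → V → Prop
  bidir : V → V → Prop
  bidir_symm : ∀ u v, bidir u v → bidir v u
  bidir_irrefl : ∀ v, ¬ bidir v v
  acyclic : ∀ v, ¬ Relation.TransGen dir v v

namespace ADMG

variable {V : Type*}

/-- Ancestors of a set of nodes, the set itself included. -/
def An (G : ADMG V) (A : Set V) : Set V :=
  {v | ∃ a ∈ A, Relation.ReflTransGen G.dir v a}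

/-- Descendants of a set of nodes, the set itself included. -/
def De (G : ADMG V) (A : Set V) : Set V :=
  {v | ∃ a ∈ A, Relation.ReflTransGen G.dir a v}

/-- Nodes outside `A` joined to a node of `A` by a bidirected arc. -/
def Nb (G : ADMG V) (A : Set V) : Set V :=
  {v | v ∉ A ∧ ∃ a ∈ A, G.bidir v a}

/-- The graph obtained by deleting all arcs incoming to `A`; a bidirected arc is incoming to both
of its endpoints. -/
def cutIn (G : ADMG V) (A : Set V) : ADMG V where
  dir u v := G.dir u v ∧ v ∉ A
  bidir u v := G.bidir u v ∧ u ∉ A ∧ v ∉ A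
  bidir_symm u v h := ⟨G.bidir_symm u v h.1, h.2.2, h.2.1⟩
  bidir_irrefl v h := G.bidir_irrefl v h.1
  acyclic v h := G.acyclic v (Relation.TransGen.mono (fun _ _ h' => h'.1) v v h)

/-- The graph obtained by deleting all directed arcs outgoing from `A`. -/
def cutOut (G : ADMG V) (A : Set V) : ADMG V where
  dir u v := G.dir u v ∧ u ∉ A
  bidir := G.bidir
  bidir_symm := G.bidir_symm
  bidir_irrefl := G.bidir_irrefl
  acyclic v h := G.acyclic v (Relation.TransGen.mono (fun _ _ h' => h'.1) v v h)

/-- The subgraph induced by `W`: only the arcs with both endpoints in `W` are kept. (The nodes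
outside `W` stay in the type, as isolated nodes.) -/
def induce (G : ADMG V) (W : Set V) : ADMG V where
  dir u v := G.dir u v ∧ u ∈ W ∧ v ∈ W
  bidir u v := G.bidir u v ∧ u ∈ W ∧ v ∈ W
  bidir_symm u v h := ⟨G.bidir_symm u v h.1, h.2.2, h.2.1⟩
  bidir_irrefl v h := G.bidir_irrefl v h.1
  acyclic v h := G.acyclic v (Relation.TransGen.mono (fun _ _ h' => h'.1) v v h)

/-- `G.Edge u hu hv v`: an arc between `u` and `v`, where `hu` (`hv`) tells whether it has an
arrowhead at `u` (at `v`). -/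
inductive Edge (G : ADMG V) : V → Bool → Bool → V → Prop
  | right {u v : V} : G.dir u v → Edge G u false true v
  | left {u v : V} : G.dir v u → Edge G u true false v
  | both {u v : V} : G.bidir u v → Edge G u true true v

/-- A path from `a` to `b`: distinct nodes `node 0, …, node len`, consecutive ones joined by an arc.
The `i`-th arc joins `node i` and `node (i + 1)`; `headL i`, `headR i` tell whether it has an
arrowhead at `node i`, at `node (i + 1)`. Values at larger indices are irrelevant. -/
structure Path (G : ADMG V) (a b : V) where
  len : ℕ
  node : ℕ → V
  headL : ℕ → Bool
  headR : ℕ → Bool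
  start_eq : node 0 = a
  end_eq : node len = b
  edge : ∀ i < len, G.Edge (node i) (headL i) (headR i) (node (i + 1))
  inj : Set.InjOn node (Set.Iic len)

/-- The interior node `node (i + 1)` is a collider on the path. -/
def Path.IsCollider {G : ADMG V} {a b : V} (π : G.Path a b) (i : ℕ) : Prop :=
  π.headR i = true ∧ π.headL (i + 1) = true

/-- The path is m-connecting given `C`: every interior collider is in `C` or has a descendant
in `C`, and no interior non-collider is in `C`. -/
def Path.IsActive {G : ADMG V} {a b : V} (π : G.Path a b) (C : Set V) : Prop :=
  ∀ i, i + 1 < π.len →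
    (π.IsCollider i → π.node (i + 1) ∈ G.An C) ∧ (¬ π.IsCollider i → π.node (i + 1) ∉ C)

/-- m-separation of `A` and `B` given `C`. -/
def MSep (G : ADMG V) (A B C : Set V) : Prop :=
  ∀ a ∈ A, ∀ b ∈ B, ∀ π : G.Path a b, ¬ π.IsActive C

theorem wellFounded_dir [Finite V] (G : ADMG V) : WellFounded G.dir := by
  have : Std.Irrefl (Relation.TransGen G.dir) := ⟨G.acyclic⟩
  exact Subrelation.wf (fun h => Relation.TransGen.single h)
    (Finite.wellFounded_of_trans_of_irrefl (Relation.TransGen G.dir))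

variable [DecidableEq V]

/-- The potential super-cause family. -/
def superCauseFamily (G : ADMG V) (X : V) (Ys : Finset V) : Set (Finset V) :=
  {S | (S : Set V) ⊆ {X} ∪ (G.An Ys \ Ys) ∧ X ∈ S}

/-- The candidate mediator region relative to `S`. -/
def mediatorRegion (G : ADMG V) (Ys S : Finset V) : Set V :=
  (G.An Ys ∩ G.De S) \ (G.Nb S ∪ G.Nb Ys ∪ S ∪ Ys)

/-- The candidate super-mediator family relative to `S`. -/
def superMediatorFamily (G : ADMG V) (Ys S : Finset V) : Set (Finset V) :=
  {M | (M : Set V) ⊆ G.mediatorRegion Ys S ∧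
    (Ys : Set V) ∩ (G.induce (M : Set V)ᶜ).De S = ∅ ∧
    (G.cutOut S).MSep S M ∅ ∧
    ∀ m ∈ M, ((G.cutIn S).cutOut {m}).MSep Ys {m} (S ∪ M.erase m : Finset V)}

/-- `(Xs, Ys, Ms)` is a front-door reducibility (FDR) triple of `G` relative to `(X, Y)`. -/
structure IsFDRTriple (G : ADMG V) (X Y : V) (Xs Ys Ms : Finset V) : Prop where
  effect : Ys = {Y}
  cause : Xs ∈ G.superCauseFamily X Ys
  mediator : Ms ∈ G.superMediatorFamily Ys Xs
  mediator_nonempty : Ms.Nonempty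

end ADMG

/-- A semi-Markovian structural causal model compatible with the ADMG `G`: each observed variable
`v`, with values in `𝒳 v`, is a measurable function of its parents in `G` and of its own error
variable, with values in `E v`; error variables may be dependent only along bidirected arcs, that
is, the errors of two disjoint sets of nodes without a bidirected arc between them are independent.
(Latent variables shared by several nodes are parts of the errors of all these nodes.) -/
structure SCM {V : Type*} (G : ADMG V) (𝒳 E : V → Type*)
    [∀ v, MeasurableSpace (𝒳 v)] [∀ v, MeasurableSpace (E v)] where
  noise : Measure (∀ v, E v)
  isProbabilityMeasure_noise : IsProbabilityMeasure noise
  indep_noise : ∀ A B : Finset V, Disjoint A B → (∀ a ∈ A, ∀ b ∈ B, ¬ G.bidir a b) →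
    IndepFun (A.restrict (π := E)) (B.restrict (π := E)) noise
  mech : ∀ v, (∀ w : {w // G.dir w v}, 𝒳 w) → E v → 𝒳 v
  measurable_mech : ∀ v, Measurable (Function.uncurry (mech v))

noncomputable section

namespace SCM

variable {V : Type*} [Fintype V] [DecidableEq V] {G : ADMG V} {𝒳 E : V → Type*}
  [∀ v, MeasurableSpace (𝒳 v)] [∀ v, MeasurableSpace (E v)]

/-- The values of all variables under the intervention `do(S = s)`, for given errors `u`: the
unique solution of the structural equations in which the mechanisms of the nodes of `S` are
replaced by the constants `s`. -/
def response (𝓜 : SCM G 𝒳 E) (S : Finset V) (s : ∀ v : S, 𝒳 v) (u : ∀ v, E v) : ∀ v, 𝒳 v :=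
  G.wellFounded_dir.fix fun v ih =>
    if h : v ∈ S then s ⟨v, h⟩ else 𝓜.mech v (fun w => ih w.1 w.2) (u v)

theorem response_eq (𝓜 : SCM G 𝒳 E) (S : Finset V) (s : ∀ v : S, 𝒳 v) (u : ∀ v, E v) (v : V) :
    𝓜.response S s u v =
      if h : v ∈ S then s ⟨v, h⟩ else 𝓜.mech v (fun w => 𝓜.response S s u w) (u v) :=
  G.wellFounded_dir.fix_eq _ v

theorem measurable_response (𝓜 : SCM G 𝒳 E) (S : Finset V) :
    Measurable fun z : (∀ v : S, 𝒳 v) × (∀ v, E v) => 𝓜.response S z.1 z.2 := by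
  refine measurable_pi_lambda _ fun v => ?_
  induction v using G.wellFounded_dir.induction with
  | _ v ih =>
    simp only [response_eq 𝓜 S _ _ v]
    by_cases h : v ∈ S
    · simp only [h, dite_true]
      fun_prop
    · simp only [h, dite_false]
      exact (𝓜.measurable_mech v).comp
        ((measurable_pi_lambda _ fun w => ih w.1 w.2).prodMk (by fun_prop))

/-- The values of the variables in `A` without any intervention, as functions of the errors. -/
def obs (𝓜 : SCM G 𝒳 E) (A : Finset V) (u : ∀ v, E v) : ∀ v : A, 𝒳 v :=
  A.restrict (𝓜.response ∅ (fun v => (Finset.notMem_empty v.1 v.2).elim) u)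

/-- The interventional distribution of the variables in `A` under `do(S = s)`. -/
def doLaw (𝓜 : SCM G 𝒳 E) (S : Finset V) (s : ∀ v : S, 𝒳 v) (A : Finset V) :
    Measure (∀ v : A, 𝒳 v) :=
  𝓜.noise.map fun u => A.restrict (𝓜.response S s u)

end SCM

/-- The reference measure for the variables in `A`: the product of the reference measures. -/
def refMeasure {V : Type*} {𝒳 : V → Type*} [∀ v, MeasurableSpace (𝒳 v)]
    (μ : ∀ v, Measure (𝒳 v)) (A : Finset V) : Measure (∀ v : A, 𝒳 v) :=
  Measure.pi fun v : A => μ v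

/-- The conditional density `p(b | a) = p(b, a) / p(a)` of `g` given `f`, with respect to the
reference measures `ν` (for `g`) and `ρ` (for `f`). -/
def condPDF {Ω α β : Type*} [MeasurableSpace Ω] [MeasurableSpace α] [MeasurableSpace β]
    (P : Measure Ω) (g : Ω → β) (ν : Measure β) (f : Ω → α) (ρ : Measure α) (b : β) (a : α) :
    ℝ≥0∞ :=
  pdf (fun ω => (g ω, f ω)) P (ν.prod ρ) (b, a) / pdf f P ρ a

/-- The right-hand side of the adjustment formula,
`∫ p(y | x', m) p(m | x) p(x') dm dx'`, for the observational distribution of `𝓜`. -/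
def fdrAdjustment {V : Type*} [Fintype V] [DecidableEq V] {G : ADMG V} {𝒳 E : V → Type*}
    [∀ v, MeasurableSpace (𝒳 v)] [∀ v, MeasurableSpace (E v)] (𝓜 : SCM G 𝒳 E)
    (μ : ∀ v, Measure (𝒳 v)) (Xs Ys Ms : Finset V)
    (x : ∀ v : Xs, 𝒳 v) (y : ∀ v : Ys, 𝒳 v) : ℝ≥0∞ :=
  ∫⁻ x', ∫⁻ m,
    condPDF 𝓜.noise (𝓜.obs Ys) (refMeasure μ Ys) (fun u => (𝓜.obs Xs u, 𝓜.obs Ms u))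
        ((refMeasure μ Xs).prod (refMeasure μ Ms)) y (x', m) *
      condPDF 𝓜.noise (𝓜.obs Ms) (refMeasure μ Ms) (𝓜.obs Xs) (refMeasure μ Xs) m x *
      pdf (𝓜.obs Xs) 𝓜.noise (refMeasure μ Xs) x'
    ∂(refMeasure μ Ms) ∂(refMeasure μ Xs)

end

/-! The graph conditions reduce the model to the classical front-door situation. Let `ξ` be the
errors of the nodes from which a directed walk avoiding the causes leads to a mediator, and `ζ`
those of the ancestors of the causes and of the nodes from which a directed walk avoiding the
mediators leads to the effect. Since FDR1 blocks every directed walk from causes to effect outside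
the mediators, the structural equations take the form `x = χ ζ`, `m = φ x ξ`, `y = ψ m ζ`, and
`do(x₀)` turns the effect into `ψ (φ x₀ ξ) ζ`.

A shared node or a bidirected arc between the two sets of nodes would give a collider-free
m-connecting path, against FDR2 (`mediator_sep_cause`) or FDR3 (`mediator_sep_effect`). So `ξ` and
`ζ` are independent.

The rest is probability. As `ξ` is independent of `x`, the law of `φ x₀ ξ` has density p(m | x₀)
(`ae_map_eq_withDensity_condPDF`). The law of `ψ m₀ ζ` has density ∫ p(y | x', m₀) p(x') dx', by
weighting with p(x) / p(x, m), which positivity makes meaningful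
(`ae_map_eq_withDensity_adjustment`). Independence lets the second family of laws be mixed over the
first, which is the formula (`ae_map_eq_withDensity_frontDoor`). -/

theorem exists_seq_of_reflTransGen {α : Type*} {r : α → α → Prop} {a b : α}
    (h : Relation.ReflTransGen r a b) :
    ∃ (n : ℕ) (f : ℕ → α), f 0 = a ∧ f n = b ∧ ∀ i < n, r (f i) (f (i + 1)) := by
  induction h using Relation.ReflTransGen.head_induction_on with
  | refl => exact ⟨0, fun _ => b, rfl, rfl, fun i hi => absurd hi (Nat.not_lt_zero i)⟩
  | @head a c hac _ ih =>
    obtain ⟨n, f, h0, hn, hf⟩ := ih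
    refine ⟨n + 1, fun i => Nat.casesOn i a f, rfl, hn, fun i hi => ?_⟩
    cases i with
    | zero => simpa [h0] using hac
    | succ i => exact hf i (by omega)

theorem transGen_of_seq {α : Type*} {r : α → α → Prop} {n : ℕ} {f : ℕ → α}
    (hf : ∀ i < n, r (f i) (f (i + 1))) {i j : ℕ} (hij : i < j) (hj : j ≤ n) :
    Relation.TransGen r (f i) (f j) := by
  induction j, hij using Nat.le_induction with
  | base => exact .single (hf i (by omega))
  | succ j hij ih => exact (ih (by omega)).tail (hf j (by omega))

/-! ### Collider-free paths built from directed walks, and m-separation -/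

namespace ADMG

variable {V : Type*}

/-- The directed arcs of `H` whose tail is not in `C`. -/
def dirAvoiding (H : ADMG V) (C : Set V) (u v : V) : Prop :=
  H.dir u v ∧ u ∉ C

/-- A repeated node would close a directed cycle. This gives the distinctness of nodes that a path
requires. -/
theorem injOn_of_dir_seq (H : ADMG V) {n : ℕ} {f : ℕ → V}
    (hf : ∀ i < n, H.dir (f i) (f (i + 1))) : Set.InjOn f (Set.Iic n) := by
  intro i hi j hj hij
  simp only [Set.mem_Iic] at hi hj
  by_contra hne
  rcases Nat.lt_or_gt_of_ne hne with h | h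
  · exact H.acyclic (f j) (by simpa [hij] using transGen_of_seq hf h hj)
  · exact H.acyclic (f j) (by simpa [hij] using transGen_of_seq hf h hi)

/-- Two directed walks to `a` and to `b`, of lengths `n` and `k`, which start at the same node and
have no other node in common, form a path without colliders. -/
theorem exists_active_path_of_fork (H : ADMG V) {C : Set V} {a b : V} {n k : ℕ} {f g : ℕ → V}
    (hfg : f 0 = g 0) (hfn : f n = a) (hgk : g k = b)
    (hf : ∀ i < n, H.dirAvoiding C (f i) (f (i + 1)))
    (hg : ∀ i < k, H.dirAvoiding C (g i) (g (i + 1)))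
    (hdisj : ∀ i ≤ n, ∀ j ≤ k, f i = g j → i = 0 ∧ j = 0) :
    ∃ π : H.Path a b, π.IsActive C := by
  have hfi := H.injOn_of_dir_seq fun i hi => (hf i hi).1
  have hgi := H.injOn_of_dir_seq fun i hi => (hg i hi).1
  -- The first walk is run backwards from `a` to the fork at index `n`, then the second one
  -- forwards. All arrowheads point away from the fork, so there is no collider, and every interior
  -- node is the tail of an arc, hence outside `C`.
  refine ⟨{ len := n + k
            node := fun i => if i ≤ n then f (n - i) else g (i - n)
            headL := fun i => decide (i < n)
            headR := fun i => decide (n ≤ i)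
            start_eq := by simpa using hfn
            end_eq := ?_
            edge := ?_
            inj := ?_ }, ?_⟩
  · rcases Nat.eq_zero_or_pos k with rfl | hk
    · simpa [hfg] using hgk
    · rw [if_neg (by omega)]
      simpa using hgk
  · intro i hi
    by_cases hin : i < n
    · have := (hf (n - (i + 1)) (by omega)).1
      rw [show n - (i + 1) + 1 = n - i by omega] at this
      simp only [hin, hin.le, Nat.succ_le_of_lt hin, if_true, decide_true]
      rw [decide_eq_false (by omega)]
      exact .left this
    · have := (hg (i - n) (by omega)).1
      rw [show i - n + 1 = i + 1 - n by omega] at this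
      rw [decide_eq_false hin, decide_eq_true (by omega), if_neg (show ¬ i + 1 ≤ n by omega)]
      split_ifs with h
      · obtain rfl : i = n := by omega
        rw [Nat.sub_self] at this ⊢
        rw [hfg]
        exact .right this
      · exact .right this
  · intro i hi j hj hij
    simp only [Set.mem_Iic] at hi hj
    dsimp only at hij
    split_ifs at hij with h1 h2 h2
    · have := hfi (by simp) (by simp) hij
      omega
    · have := hdisj _ (by omega) _ (by omega) hij
      omega
    · have := hdisj _ (by omega) _ (by omega) hij.symm
      omega
    · have := hgi (by simp; omega) (by simp; omega) hij
      omega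
  · intro i hi
    dsimp only at hi ⊢
    refine ⟨fun hc => ?_, fun _ => ?_⟩
    · simp only [Path.IsCollider, decide_eq_true_eq] at hc
      omega
    · split_ifs with h
      · exact (hf _ (by omega)).2
      · exact (hg _ (by omega)).2

/-- Two disjoint directed walks whose starting nodes are joined by a bidirected arc form a path
without colliders. -/
theorem exists_active_path_of_bidir (H : ADMG V) {C : Set V} {a b : V} {n k : ℕ} {f g : ℕ → V}
    (hfg : H.bidir (f 0) (g 0)) (hfn : f n = a) (hgk : g k = b)
    (hf : ∀ i < n, H.dirAvoiding C (f i) (f (i + 1)))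
    (hg : ∀ i < k, H.dirAvoiding C (g i) (g (i + 1)))
    (hdisj : ∀ i ≤ n, ∀ j ≤ k, f i ≠ g j) :
    ∃ π : H.Path a b, π.IsActive C := by
  have hfi := H.injOn_of_dir_seq fun i hi => (hf i hi).1
  have hgi := H.injOn_of_dir_seq fun i hi => (hg i hi).1
  -- The arc of index `n` is the bidirected one, with an arrowhead at both ends; the others point
  -- away from it. Again each interior node is the tail of a directed arc.
  refine ⟨{ len := n + k + 1
            node := fun i => if i ≤ n then f (n - i) else g (i - (n + 1))
            headL := fun i => decide (i ≤ n)
            headR := fun i => decide (n ≤ i)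
            start_eq := by simpa using hfn
            end_eq := ?_
            edge := ?_
            inj := ?_ }, ?_⟩
  · rw [if_neg (by omega), show n + k + 1 - (n + 1) = k by omega, hgk]
  · intro i hi
    rcases lt_trichotomy i n with hin | rfl | hin
    · have := (hf (n - (i + 1)) (by omega)).1
      rw [show n - (i + 1) + 1 = n - i by omega] at this
      simp only [hin.le, Nat.succ_le_of_lt hin, if_true, decide_true]
      rw [decide_eq_false (by omega)]
      exact .left this
    · simpa using Edge.both hfg
    · have := (hg (i - (n + 1)) (by omega)).1
      rw [show i - (n + 1) + 1 = i + 1 - (n + 1) by omega] at this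
      rw [decide_eq_false (by omega), decide_eq_true (by omega),
        if_neg (show ¬ i + 1 ≤ n by omega), if_neg (show ¬ i ≤ n by omega)]
      exact .right this
  · intro i hi j hj hij
    simp only [Set.mem_Iic] at hi hj
    dsimp only at hij
    split_ifs at hij with h1 h2 h2
    · have := hfi (by simp) (by simp) hij
      omega
    · exact absurd hij (hdisj _ (by omega) _ (by omega))
    · exact absurd hij.symm (hdisj _ (by omega) _ (by omega))
    · have := hgi (by simp; omega) (by simp; omega) hij
      omega
  · intro i hi
    dsimp only at hi ⊢
    refine ⟨fun hc => ?_, fun _ => ?_⟩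
    · simp only [Path.IsCollider, decide_eq_true_eq] at hc
      omega
    · split_ifs with h
      · exact (hf _ (by omega)).2
      · exact (hg _ (by omega)).2

/-- m-separated sets have no common ancestor along directed walks avoiding the separator. -/
theorem MSep.no_common_ancestor {H : ADMG V} {A B C : Set V} (hs : H.MSep A B C) {a b c : V}
    (ha : a ∈ A) (hb : b ∈ B) (hca : Relation.ReflTransGen (H.dirAvoiding C) c a)
    (hcb : Relation.ReflTransGen (H.dirAvoiding C) c b) : False := by
  obtain ⟨n, f, hf0, hfn, hf⟩ := exists_seq_of_reflTransGen hca
  obtain ⟨k, g, hg0, hgk, hg⟩ := exists_seq_of_reflTransGen hcb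
  have hfg : f 0 = g 0 := hf0.trans hg0.symm
  clear hf0 hg0 hca hcb
  -- If the walks meet again, dropping their segments before that meeting point leaves a shorter
  -- pair with a common start.
  induction hN : n + k using Nat.strong_induction_on generalizing n k f g with
  | _ N ih =>
    by_cases hdisj : ∀ i ≤ n, ∀ j ≤ k, f i = g j → i = 0 ∧ j = 0
    · obtain ⟨π, hπ⟩ := H.exists_active_path_of_fork hfg hfn hgk hf hg hdisj
      exact hs a ha b hb π hπ
    · push Not at hdisj
      obtain ⟨i, hi, j, hj, hij, hne⟩ := hdisj
      have hpos : 0 < i + j := by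
        by_contra h
        exact hne (by omega) (by omega)
      refine ih ((n - i) + (k - j)) (by omega) (n - i) (fun l => f (i + l))
        (by simpa [Nat.add_sub_cancel' hi] using hfn) (fun l hl => hf (i + l) (by omega))
        (k - j) (fun l => g (j + l)) (by simpa [Nat.add_sub_cancel' hj] using hgk)
        (fun l hl => hg (j + l) (by omega)) (by simpa using hij) rfl

/-- Ancestors of m-separated sets, along directed walks avoiding the separator, are not joined by
a bidirected arc. -/
theorem MSep.no_bidir_ancestor {H : ADMG V} {A B C : Set V} (hs : H.MSep A B C) {a b c d : V}
    (ha : a ∈ A) (hb : b ∈ B) (hca : Relation.ReflTransGen (H.dirAvoiding C) c a)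
    (hdb : Relation.ReflTransGen (H.dirAvoiding C) d b) : ¬ H.bidir c d := by
  intro hcd
  obtain ⟨n, f, hf0, hfn, hf⟩ := exists_seq_of_reflTransGen hca
  obtain ⟨k, g, hg0, hgk, hg⟩ := exists_seq_of_reflTransGen hdb
  have hreach : ∀ {n : ℕ} {f : ℕ → V}, (∀ i < n, H.dirAvoiding C (f i) (f (i + 1))) →
      ∀ i ≤ n, Relation.ReflTransGen (H.dirAvoiding C) (f i) (f n) := by
    intro n f hf i hi
    rcases hi.eq_or_lt with rfl | hi
    · exact .refl
    · exact (transGen_of_seq hf hi le_rfl).to_reflTransGen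
  -- The walks are disjoint, since a shared node would be a common ancestor.
  obtain ⟨π, hπ⟩ := H.exists_active_path_of_bidir (hf0 ▸ hg0 ▸ hcd) hfn hgk hf hg
    fun i hi j hj hij => hs.no_common_ancestor ha hb (hfn ▸ hreach hf i hi)
      (hgk ▸ hij ▸ hreach hg j hj)
  exact hs a ha b hb π hπ

theorem mem_An_of_dir {G : ADMG V} {A : Set V} {v w : V} (hv : v ∈ G.An A) (h : G.dir w v) :
    w ∈ G.An A := by
  obtain ⟨a, ha, hva⟩ := hv
  exact ⟨a, ha, .head h hva⟩

theorem subset_An (G : ADMG V) (A : Set V) : A ⊆ G.An A :=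
  fun a ha => ⟨a, ha, .refl⟩

/-- A nontrivial walk starts with an arc kept in the induced graph. The deleted nodes survive as
isolated ones, so the trivial walk needs the disjointness. -/
theorem notMem_of_mem_An_induce {G : ADMG V} {A B : Set V} (hAB : Disjoint A B) {v : V}
    (hv : v ∈ (G.induce Bᶜ).An A) : v ∉ B := by
  obtain ⟨a, ha, hva⟩ := hv
  rcases Relation.ReflTransGen.cases_head hva with rfl | ⟨w, hvw, _⟩
  · exact fun hb => (Set.disjoint_left.mp hAB) ha hb
  · exact hvw.2.1

/-- A directed walk to a set, cut at its first node in that set. -/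
theorem exists_reflTransGen_notMem {r : V → V → Prop} {A : Set V} {v a : V}
    (h : Relation.ReflTransGen r v a) (ha : a ∈ A) :
    ∃ a' ∈ A, Relation.ReflTransGen (fun u w => r u w ∧ u ∉ A) v a' := by
  induction h using Relation.ReflTransGen.head_induction_on with
  | refl => exact ⟨a, ha, .refl⟩
  | @head u w huw _ ih =>
    by_cases hu : u ∈ A
    · exact ⟨u, hu, .refl⟩
    · obtain ⟨a', ha', h'⟩ := ih
      exact ⟨a', ha', .head ⟨huw, hu⟩ h'⟩

/-! ### Separation of the two groups of nodes by the FDR conditions -/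

variable [DecidableEq V]

theorem disjoint_cause_mediator {G : ADMG V} {S Ys M : Finset V}
    (hM : M ∈ G.superMediatorFamily Ys S) : Disjoint (M : Set V) S :=
  Set.disjoint_left.mpr fun _ hv hS => (hM.1 hv).2 (.inl (.inr hS))

theorem disjoint_effect_mediator {G : ADMG V} {S Ys M : Finset V}
    (hM : M ∈ G.superMediatorFamily Ys S) : Disjoint (Ys : Set V) M :=
  Set.disjoint_left.mpr fun _ hY hv => (hM.1 hv).2 (.inr hY)

/-- No cause is an ancestor of the effect along a directed walk avoiding the mediators. -/
theorem notMem_cause_of_mem_An_effect {G : ADMG V} {S Ys M : Finset V}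
    (hM : M ∈ G.superMediatorFamily Ys S) {v : V} (hv : v ∈ (G.induce (M : Set V)ᶜ).An Ys) :
    v ∉ S := by
  intro hS
  obtain ⟨y, hy, hvy⟩ := hv
  have : y ∈ (Ys : Set V) ∩ (G.induce (M : Set V)ᶜ).De S := ⟨hy, v, hS, hvy⟩
  rw [hM.2.1] at this
  exact this

/-- The nodes on which the response of the mediators to the causes depends are separated from the
ancestors of the causes. -/
theorem mediator_sep_cause {G : ADMG V} {S Ys M : Finset V}
    (hM : M ∈ G.superMediatorFamily Ys S) {v w : V} (hv : v ∈ (G.induce (S : Set V)ᶜ).An M)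
    (hw : w ∈ G.An S) : v ≠ w ∧ ¬ G.bidir v w := by
  obtain ⟨m, hm, hvm⟩ := hv
  obtain ⟨s, hs, hws⟩ := hw
  -- Stopping at the first cause keeps the walk in the graph without arcs outgoing from causes,
  -- where FDR2 applies.
  obtain ⟨s', hs', hws'⟩ := exists_reflTransGen_notMem hws hs
  have h1 : Relation.ReflTransGen ((G.cutOut S).dirAvoiding ∅) w s' :=
    Relation.ReflTransGen.mono (fun _ _ h => ⟨h, Set.notMem_empty _⟩) _ _ hws'
  have h2 : Relation.ReflTransGen ((G.cutOut S).dirAvoiding ∅) v m :=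
    Relation.ReflTransGen.mono (fun _ _ h => ⟨⟨h.1, h.2.1⟩, Set.notMem_empty _⟩) _ _ hvm
  refine ⟨?_, fun hb => hM.2.2.1.no_bidir_ancestor hs' hm h1 h2 (G.bidir_symm _ _ hb)⟩
  rintro rfl
  exact hM.2.2.1.no_common_ancestor hs' hm h1 h2

/-- The nodes on which the response of the mediators to the causes depends are separated from those
on which the response of the effect to the mediators depends. -/
theorem mediator_sep_effect {G : ADMG V} {S Ys M : Finset V}
    (hM : M ∈ G.superMediatorFamily Ys S) {v w : V} (hv : v ∈ (G.induce (S : Set V)ᶜ).An M)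
    (hw : w ∈ (G.induce (M : Set V)ᶜ).An Ys) : v ≠ w ∧ ¬ G.bidir v w := by
  have hvS := notMem_of_mem_An_induce (disjoint_cause_mediator hM) hv
  have hwS := notMem_cause_of_mem_An_effect hM hw
  obtain ⟨m₀, hm₀, hvm₀⟩ := hv
  -- The first mediator `m` on the walk is the one for which FDR3 is used: no earlier node is a
  -- cause or a mediator, so the walk survives both deletions and avoids the conditioning set.
  obtain ⟨m, hm, hvm⟩ := exists_reflTransGen_notMem hvm₀ hm₀
  obtain ⟨y, hy, hwy⟩ := hw
  have h1 : Relation.ReflTransGen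
      (((G.cutIn S).cutOut {m}).dirAvoiding (S ∪ M.erase m : Finset V)) v m := by
    refine Relation.ReflTransGen.mono (fun a b h => ⟨⟨⟨h.1.1, h.1.2.2⟩, ?_⟩, ?_⟩) _ _ hvm
    · rintro rfl
      exact h.2 hm
    · have h1 : a ∉ S := h.1.2.1
      have h2 : a ∉ M := h.2
      simp [h1, h2]
  have h2 : Relation.ReflTransGen
      (((G.cutIn S).cutOut {m}).dirAvoiding (S ∪ M.erase m : Finset V)) w y := by
    clear hwS
    induction hwy using Relation.ReflTransGen.head_induction_on with
    | refl => exact .refl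
    | @head a b hab hby ih =>
      have ha := notMem_cause_of_mem_An_effect hM ⟨y, hy, .head hab hby⟩
      have hb := notMem_cause_of_mem_An_effect hM ⟨y, hy, hby⟩
      have ha' : a ∉ M := hab.2.1
      refine .head ⟨⟨⟨hab.1, hb⟩, ?_⟩, ?_⟩ ih
      · rintro rfl
        exact ha' hm
      · simp [ha, ha']
  -- The bidirected arc survives the deletion of arcs into causes because neither endpoint is a
  -- cause.
  refine ⟨?_, fun hb =>
    (hM.2.2.2 m hm).no_bidir_ancestor hy rfl h2 h1 ⟨G.bidir_symm _ _ hb, hwS, hvS⟩⟩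
  rintro rfl
  exact (hM.2.2.2 m hm).no_common_ancestor hy rfl h2 h1

end ADMG

/-! ### Which errors the responses depend on -/

/-- The values given on `A` are extended by default values. -/
def Finset.extendBy {V : Type*} [DecidableEq V] {E : V → Type*} (A : Finset V) (u₀ : ∀ v, E v) (u : ∀ v : A, E v) : ∀ v, E v :=
  fun v => if h : v ∈ A then u ⟨v, h⟩ else u₀ v

theorem Finset.measurable_extendBy {V : Type*} [DecidableEq V] {E : V → Type*}
    [∀ v, MeasurableSpace (E v)] (A : Finset V) (u₀ : ∀ v, E v) :
    Measurable (A.extendBy u₀) := by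
  refine measurable_pi_lambda _ fun v => ?_
  unfold Finset.extendBy
  by_cases h : v ∈ A
  · simp only [h, dite_true]
    fun_prop
  · simp only [h, dite_false]
    fun_prop

namespace SCM

variable {V : Type*} [Fintype V] [DecidableEq V] {G : ADMG V} {𝒳 E : V → Type*}
  [∀ v, MeasurableSpace (𝒳 v)] [∀ v, MeasurableSpace (E v)]

/-- Responses to two interventions agree on a set `W` if, at each node of `W`, they are known to
agree or the same structural equation holds and the parents are in `W`. -/
theorem response_congr (𝓜 : SCM G 𝒳 E) {S S' : Finset V} {s : ∀ v : S, 𝒳 v} {s' : ∀ v : S', 𝒳 v}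
    {u u' : ∀ v, E v} (W : Set V)
    (h : ∀ v ∈ W, 𝓜.response S s u v = 𝓜.response S' s' u' v ∨
      (v ∉ S ∧ v ∉ S' ∧ u v = u' v ∧ ∀ w, G.dir w v → w ∈ W)) :
    ∀ v ∈ W, 𝓜.response S s u v = 𝓜.response S' s' u' v := by
  intro v
  induction v using G.wellFounded_dir.induction with
  | _ v ih =>
    intro hv
    rcases h v hv with h | ⟨hS, hS', hu, hpa⟩
    · exact h
    · rw [response_eq, response_eq 𝓜 S', dif_neg hS, dif_neg hS', hu]
      congr 1
      funext w
      exact ih w w.2 (hpa w w.2)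

theorem response_of_mem (𝓜 : SCM G 𝒳 E) {S : Finset V} (s : ∀ v : S, 𝒳 v) (u : ∀ v, E v) {v : V}
    (hv : v ∈ S) : 𝓜.response S s u v = s ⟨v, hv⟩ := by
  rw [response_eq, dif_pos hv]

theorem obs_apply (𝓜 : SCM G 𝒳 E) (A : Finset V) (u : ∀ v, E v) (v : A) :
    𝓜.obs A u v = 𝓜.response ∅ (fun v => (Finset.notMem_empty v.1 v.2).elim) u v :=
  rfl

theorem measurable_response_right (𝓜 : SCM G 𝒳 E) (S : Finset V) (s : ∀ v : S, 𝒳 v) :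
    Measurable (𝓜.response S s) :=
  (𝓜.measurable_response S).comp (measurable_const.prodMk measurable_id)

theorem measurable_obs (𝓜 : SCM G 𝒳 E) (A : Finset V) : Measurable (𝓜.obs A) :=
  (Finset.measurable_restrict A).comp (𝓜.measurable_response_right ∅ _)

/-- Consistency: intervening with the observed values changes nothing. -/
theorem response_obs (𝓜 : SCM G 𝒳 E) (S : Finset V) (u : ∀ v, E v) (v : V) :
    𝓜.response S (𝓜.obs S u) u v =
      𝓜.response ∅ (fun v => (Finset.notMem_empty v.1 v.2).elim) u v := by
  refine 𝓜.response_congr Set.univ (fun v _ => ?_) v (Set.mem_univ v)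
  by_cases hv : v ∈ S
  · exact .inl (by rw [response_of_mem _ _ _ hv, obs_apply])
  · exact .inr ⟨hv, Finset.notMem_empty v, rfl, fun _ _ => Set.mem_univ _⟩

/-- The response to `do(S = s)` of the ancestors of `A` outside `S` depends only on the errors of
the nodes from which a directed walk avoiding `S` leads to `A`. -/
theorem response_eq_of_eqOn_An_induce (𝓜 : SCM G 𝒳 E) {S : Finset V} {A : Set V}
    (hA : Disjoint A S) (s : ∀ v : S, 𝒳 v) {u u' : ∀ v, E v}
    (h : ∀ v ∈ (G.induce (S : Set V)ᶜ).An A, u v = u' v) {v : V} (hv : v ∈ A) :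
    𝓜.response S s u v = 𝓜.response S s u' v := by
  -- A parent of an ancestor in the induced graph is either such an ancestor itself or in `S`, where
  -- the value is prescribed.
  refine 𝓜.response_congr ((G.induce (S : Set V)ᶜ).An A ∪ S) (fun v hv => ?_) v
    (.inl (ADMG.subset_An _ _ hv))
  rcases hv with hv | hv
  · have hvS := ADMG.notMem_of_mem_An_induce hA hv
    refine .inr ⟨hvS, hvS, h v hv, fun w hw => ?_⟩
    by_cases hwS : w ∈ (S : Set V)
    · exact .inr hwS
    · exact .inl (ADMG.mem_An_of_dir hv ⟨hw, hwS, hvS⟩)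
  · exact .inl (by rw [response_of_mem _ _ _ hv, response_of_mem _ _ _ hv])

/-- The observational values on `A` depend only on the errors of the ancestors of `A`. -/
theorem obs_eq_of_eqOn_An (𝓜 : SCM G 𝒳 E) {A : Finset V} {u u' : ∀ v, E v}
    (h : ∀ v ∈ G.An A, u v = u' v) : 𝓜.obs A u = 𝓜.obs A u' := by
  funext v
  rw [obs_apply, obs_apply]
  refine 𝓜.response_congr (G.An A) (fun v hv => .inr ⟨Finset.notMem_empty v, Finset.notMem_empty v,
    h v hv, fun w hw => ADMG.mem_An_of_dir hv hw⟩) v (ADMG.subset_An _ _ v.2)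

/-- If every directed walk from `S` to `A` meets `M`, then the effect of `do(S = s)` on `A` is the
effect of setting `M` to its response to `do(S = s)`. -/
theorem response_eq_response_mediator (𝓜 : SCM G 𝒳 E) {S M : Finset V} {A : Set V}
    (hA : Disjoint A M) (hS : ∀ v ∈ (G.induce (M : Set V)ᶜ).An A, v ∉ S) (s : ∀ v : S, 𝒳 v)
    (u : ∀ v, E v) {v : V} (hv : v ∈ A) :
    𝓜.response S s u v = 𝓜.response M (M.restrict (𝓜.response S s u)) u v := by
  -- On `M` the two responses agree by the choice of the prescribed values; at the other nodes of
  -- this set neither intervention replaces the mechanism.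
  refine 𝓜.response_congr ((G.induce (M : Set V)ᶜ).An A ∪ M) (fun v hv => ?_) v
    (.inl (ADMG.subset_An _ _ hv))
  rcases hv with hv | hv
  · have hvM := ADMG.notMem_of_mem_An_induce hA hv
    refine .inr ⟨hS v hv, hvM, rfl, fun w hw => ?_⟩
    by_cases hwM : w ∈ (M : Set V)
    · exact .inr hwM
    · exact .inl (ADMG.mem_An_of_dir hv ⟨hw, hwM, hvM⟩)
  · exact .inl (by rw [response_of_mem 𝓜 (S := M) _ _ hv]; rfl)

end SCM

/-! ### Almost sure equality of measures, and marginal densities -/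

/-- The product σ-algebra is the supremum of countably many pullbacks by coordinates, so the union
of their countable generating families generates it. -/
theorem MeasurableSpace.CountablyGenerated.pi {ι : Type*} [Countable ι] {α : ι → Type*}
    [m : ∀ i, MeasurableSpace (α i)] [h : ∀ i, MeasurableSpace.CountablyGenerated (α i)] :
    MeasurableSpace.CountablyGenerated (∀ i, α i) := by
  choose b hbc hb using fun i => (CountablyGenerated.comap (m := m i) (Function.eval i :
    (∀ i, α i) → α i)).isCountablyGenerated
  refine ⟨⋃ i, b i, Set.countable_iUnion hbc, ?_⟩
  rw [← MeasurableSpace.iSup_generateFrom]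
  exact iSup_congr hb

namespace MeasureTheory

/-- Families of measures on a countably generated space which agree almost surely on each
measurable set agree almost surely. -/
theorem ae_measure_eq_of_forall_ae_apply_eq {α β : Type*} [MeasurableSpace α] [MeasurableSpace β]
    [MeasurableSpace.CountablyGenerated β] {ρ : Measure α} {κ η : α → Measure β}
    [∀ a, IsFiniteMeasure (κ a)] (h : ∀ t, MeasurableSet t → ∀ᵐ a ∂ρ, κ a t = η a t) :
    ∀ᵐ a ∂ρ, κ a = η a := by
  -- This algebra is still countable, so a single null set serves all its members; being closed
  -- under intersections, it determines finite measures of equal total mass.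
  set C := generateSetAlgebra (MeasurableSpace.countableGeneratingSet β)
  have hgen : MeasurableSpace.generateFrom C = ‹MeasurableSpace β› := by
    rw [generateFrom_generateSetAlgebra_eq, MeasurableSpace.generateFrom_countableGeneratingSet]
  have hmeas : ∀ t ∈ C, MeasurableSet t := fun t ht => by
    rw [← hgen]
    exact MeasurableSpace.measurableSet_generateFrom ht
  have hC : C.Countable :=
    countable_generateSetAlgebra MeasurableSpace.countable_countableGeneratingSet
  filter_upwards [(ae_ball_iff hC).mpr fun t ht => h t (hmeas t ht), h _ MeasurableSet.univ]
    with a ha huniv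
  exact ext_of_generate_finite C hgen.symm
    (fun s hs t ht _ => isSetAlgebra_generateSetAlgebra.inter_mem hs ht) ha huniv

section Density

variable {Ω α β : Type*} [MeasurableSpace Ω] [MeasurableSpace α] [MeasurableSpace β]
  {P : Measure Ω} {f : Ω → α} {g : Ω → β} {μ : Measure α} {ν : Measure β}

theorem map_absolutelyContinuous_of_prod_snd (hf : Measurable f) (hg : Measurable g)
    (h : P.map (fun ω => (f ω, g ω)) ≪ μ.prod ν) : P.map g ≪ ν := by
  have := (h.map measurable_snd).trans Measure.quasiMeasurePreserving_snd.absolutelyContinuous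
  rwa [Measure.map_map measurable_snd (hf.prodMk hg)] at this

theorem map_prod_swap_absolutelyContinuous [SFinite μ] [SFinite ν] (hf : Measurable f)
    (hg : Measurable g) (h : P.map (fun ω => (f ω, g ω)) ≪ μ.prod ν) :
    P.map (fun ω => (g ω, f ω)) ≪ ν.prod μ := by
  have := h.map measurable_swap
  rwa [Measure.map_map measurable_swap (hf.prodMk hg), Measure.prod_swap] at this

theorem measurable_pdf_prodMk_right (P : Measure Ω) (μ : Measure α) (ν : Measure β) (f : Ω → α)
    (g : Ω → β) (b : β) :
    Measurable fun a => pdf (fun ω => (f ω, g ω)) P (μ.prod ν) (a, b) :=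
  (measurable_pdf _ P _).comp (measurable_id.prodMk measurable_const)

variable [IsFiniteMeasure P] [SigmaFinite μ] [SigmaFinite ν]

theorem setLIntegral_pdf_of_absolutelyContinuous (h : P.map f ≪ μ) (s : Set α) :
    ∫⁻ a in s, pdf f P μ a ∂μ = P.map f s :=
  Measure.setLIntegral_rnDeriv h s

/-- A marginal density is the integral of the joint density. -/
theorem pdf_snd_ae_eq (hf : Measurable f) (hg : Measurable g)
    (h : P.map (fun ω => (f ω, g ω)) ≪ μ.prod ν) :
    pdf g P ν =ᵐ[ν] fun b => ∫⁻ a, pdf (fun ω => (f ω, g ω)) P (μ.prod ν) (a, b) ∂μ := by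
  have hm := measurable_pdf (fun ω => (f ω, g ω)) P (μ.prod ν)
  refine ae_eq_of_forall_setLIntegral_eq_of_sigmaFinite (measurable_pdf g P ν)
    hm.lintegral_prod_left' fun s hs _ => ?_
  rw [setLIntegral_pdf_of_absolutelyContinuous (map_absolutelyContinuous_of_prod_snd hf hg h),
    ← lintegral_prod_symm' _ hm, ← Measure.restrict_univ (μ := μ), Measure.prod_restrict,
    Measure.restrict_univ, setLIntegral_pdf_of_absolutelyContinuous h,
    Measure.map_apply hg hs, Measure.map_apply (hf.prodMk hg) (MeasurableSet.univ.prod hs)]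
  congr 1
  ext ω
  simp

/-- The densities for the two orders of a pair are chosen separately, so they correspond only almost
everywhere. Needed because p(m | x) is defined from the density of `(m, x)` and positivity concerns
that of `(x, m)`. -/
theorem pdf_prod_swap_ae_eq (hf : Measurable f) (hg : Measurable g)
    (h : P.map (fun ω => (f ω, g ω)) ≪ μ.prod ν) :
    ∀ᵐ z ∂ν.prod μ, pdf (fun ω => (g ω, f ω)) P (ν.prod μ) z =
      pdf (fun ω => (f ω, g ω)) P (μ.prod ν) z.swap := by
  have hm := measurable_pdf (fun ω => (f ω, g ω)) P (μ.prod ν)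
  refine ae_eq_of_forall_setLIntegral_eq_of_sigmaFinite (measurable_pdf _ P (ν.prod μ))
    (hm.comp measurable_swap) fun s hs _ => ?_
  have hsw := (Measure.measurePreserving_swap (μ := ν) (ν := μ)).setLIntegral_comp_preimage
    (measurable_swap hs : MeasurableSet (Prod.swap ⁻¹' s)) hm
  rw [setLIntegral_pdf_of_absolutelyContinuous (map_prod_swap_absolutelyContinuous hf hg h)]
  refine Eq.trans ?_ hsw.symm
  rw [setLIntegral_pdf_of_absolutelyContinuous h, Measure.map_apply (hg.prodMk hf) hs,
    Measure.map_apply (hf.prodMk hg) (measurable_swap hs)]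
  rfl

theorem pdf_ne_top (f : Ω → α) (P : Measure Ω) [IsFiniteMeasure P] (μ : Measure α) :
    ∀ᵐ a ∂μ, pdf f P μ a ≠ ∞ := by
  filter_upwards [Measure.rnDeriv_lt_top (P.map f) μ] with a ha using ha.ne

theorem map_eq_withDensity_pdf' (h : P.map f ≪ μ) : μ.withDensity (pdf f P μ) = P.map f :=
  Measure.withDensity_rnDeriv_eq _ _ h

/-- Where a marginal density vanishes, the joint density vanishes. -/
theorem pdf_prod_eq_zero_of_pdf_snd_eq_zero (hf : Measurable f) (hg : Measurable g)
    (h : P.map (fun ω => (f ω, g ω)) ≪ μ.prod ν) :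
    ∀ᵐ b ∂ν, pdf g P ν b = 0 → ∀ᵐ a ∂μ, pdf (fun ω => (f ω, g ω)) P (μ.prod ν) (a, b) = 0 := by
  filter_upwards [pdf_snd_ae_eq hf hg h] with b hb hb0
  rw [hb] at hb0
  exact (lintegral_eq_zero_iff (measurable_pdf_prodMk_right P μ ν f g b)).mp hb0

end Density

end MeasureTheory

theorem measurable_condPDF {Ω α β : Type*} [MeasurableSpace Ω] [MeasurableSpace α]
    [MeasurableSpace β] (P : Measure Ω) (g : Ω → β) (ν : Measure β) (f : Ω → α) (ρ : Measure α) :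
    Measurable fun z : β × α => condPDF P g ν f ρ z.1 z.2 :=
  (measurable_pdf _ P _).div ((measurable_pdf _ P _).comp measurable_snd)

theorem ProbabilityTheory.IndepFun.lintegral_comp_prod {Ω α β : Type*} [MeasurableSpace Ω]
    [MeasurableSpace α] [MeasurableSpace β] {P : Measure Ω} [IsFiniteMeasure P] {f : Ω → α}
    {g : Ω → β} (hfg : IndepFun f g P) (hf : Measurable f) (hg : Measurable g)
    {h : α → β → ℝ≥0∞} (hh : Measurable (Function.uncurry h)) :
    ∫⁻ ω, h (f ω) (g ω) ∂P = ∫⁻ b, ∫⁻ a, h a b ∂(P.map f) ∂(P.map g) := by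
  have := (indepFun_iff_map_prod_eq_prod_map_map hf.aemeasurable hg.aemeasurable).mp hfg
  have h' := lintegral_prod_symm' (μ := P.map f) (ν := P.map g) (Function.uncurry h) hh
  rw [← this, lintegral_map hh (hf.prodMk hg)] at h'
  exact h'

theorem measurable_condPDF_left {Ω α β : Type*} [MeasurableSpace Ω] [MeasurableSpace α]
    [MeasurableSpace β] (P : Measure Ω) (g : Ω → β) (ν : Measure β) (f : Ω → α) (ρ : Measure α)
    (a : α) : Measurable fun b => condPDF P g ν f ρ b a :=
  (measurable_condPDF P g ν f ρ).comp (measurable_id.prodMk measurable_const)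

/-! ### The front-door formula for two independent sources of randomness -/

section FrontDoor

variable {Ω Ξ 𝕏 𝕄 𝕐 Z : Type*} [MeasurableSpace Ω] [MeasurableSpace Ξ] [MeasurableSpace 𝕏]
  [MeasurableSpace 𝕄] [MeasurableSpace 𝕐] [MeasurableSpace Z]
  {P : Measure Ω} [IsProbabilityMeasure P] {ξ : Ω → Ξ} {ζ : Ω → Z}
  {x : Ω → 𝕏} {m : Ω → 𝕄} {y : Ω → 𝕐} {φ : 𝕏 → Ξ → 𝕄} {χ : Z → 𝕏} {ψ : 𝕄 → Z → 𝕐}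
  {μX : Measure 𝕏} {μM : Measure 𝕄} {μY : Measure 𝕐}
  [SigmaFinite μX] [SigmaFinite μM] [SigmaFinite μY]

/-- If `m = φ x ξ` with `ξ` independent of `x`, then the law of `φ x₀ ξ` has the conditional density
of `m` given `x = x₀`, for almost every `x₀`. -/
theorem ae_map_eq_withDensity_condPDF [MeasurableSpace.CountablyGenerated 𝕄] (hξ : Measurable ξ)
    (hx : Measurable x) (hind : IndepFun ξ x P) (hφ : Measurable (Function.uncurry φ))
    (hm : m = fun ω => φ (x ω) (ξ ω))
    (hac : P.map (fun ω => (m ω, x ω)) ≪ μM.prod μX) :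
    ∀ᵐ x₀ ∂P.map x, (P.map ξ).map (φ x₀) =
      μM.withDensity fun m₀ => condPDF P m μM x μX m₀ x₀ := by
  have hmm : Measurable m := by
    rw [hm]
    exact hφ.comp (hx.prodMk hξ)
  have hφr : ∀ x₀, Measurable (φ x₀) := fun x₀ => hφ.of_uncurry_left
  have := Measure.isProbabilityMeasure_map (μ := P) hξ.aemeasurable
  have hacx := map_absolutelyContinuous_of_prod_snd hmm hx hac
  refine ae_measure_eq_of_forall_ae_apply_eq fun t ht => ?_
  have hpre : MeasurableSet (Function.uncurry φ ⁻¹' t) := hφ ht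
  have hK := measurable_condPDF P m μM x μX
  have hKt : Measurable fun x₀ => ∫⁻ m₀ in t, condPDF P m μM x μX m₀ x₀ ∂μM :=
    hK.lintegral_prod_left'
  have hleft : Measurable fun x₀ => (P.map ξ).map (φ x₀) t := by
    simp_rw [Measure.map_apply (hφr _) ht]
    exact measurable_measure_prodMk_left hpre
  simp_rw [withDensity_apply _ ht]
  refine ae_eq_of_forall_setLIntegral_eq_of_sigmaFinite hleft hKt fun s hs _ => ?_
  -- By independence, averaging the law of `φ x₀ ξ` over the law of `x` recovers the joint law.
  have h1 : ∫⁻ x₀ in s, (P.map ξ).map (φ x₀) t ∂P.map x = P.map (fun ω => (m ω, x ω)) (t ×ˢ s) := by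
    have h := hind.lintegral_comp_prod hξ hx
      (h := fun e x₀ => s.indicator 1 x₀ * t.indicator 1 (φ x₀ e)) (by
        refine Measurable.mul ?_ ?_
        · exact (measurable_one.indicator hs).comp measurable_snd
        · exact (measurable_one.indicator ht).comp (hφ.comp measurable_swap))
    rw [Measure.map_apply (hmm.prodMk hx) (ht.prod hs), ← lintegral_indicator hs,
      ← lintegral_indicator_one ((hmm.prodMk hx) (ht.prod hs))]
    refine Eq.trans (lintegral_congr fun x₀ => ?_) (h.symm.trans (lintegral_congr fun ω => ?_))
    · rw [← lintegral_map (f := fun m₀ => s.indicator 1 x₀ * t.indicator 1 m₀)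
        ((measurable_one.indicator ht).const_mul _) (hφr x₀),
        lintegral_const_mul _ (measurable_one.indicator ht), lintegral_indicator_one ht]
      by_cases hs : x₀ ∈ s <;> simp [hs]
    · rw [hm]
      by_cases h1 : x ω ∈ s <;> by_cases h2 : φ (x ω) (ξ ω) ∈ t <;> simp [h1, h2]
  rw [h1, ← setLIntegral_pdf_of_absolutelyContinuous hac, ← Measure.prod_restrict,
    lintegral_prod_symm' _ (measurable_pdf _ P _), ← map_eq_withDensity_pdf' hacx,
    restrict_withDensity hs, lintegral_withDensity_eq_lintegral_mul _ (measurable_pdf _ P _) hKt]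
  refine lintegral_congr_ae (ae_restrict_of_ae ?_)
  filter_upwards [pdf_ne_top x P μX, pdf_prod_eq_zero_of_pdf_snd_eq_zero hmm hx hac]
    with x₀ htop hzero
  rw [Pi.mul_apply, ← lintegral_const_mul _ (measurable_condPDF_left P m μM x μX x₀)]
  refine lintegral_congr_ae (ae_restrict_of_ae ?_)
  -- Where p(x₀) vanishes, so does the joint density for almost every `m₀`; elsewhere p(x₀), being
  -- finite, cancels.
  by_cases h0 : pdf x P μX x₀ = 0
  · filter_upwards [hzero h0] with m₀ hm₀
    rw [hm₀, h0, zero_mul]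
  · refine Filter.Eventually.of_forall fun m₀ => ?_
    exact (ENNReal.mul_div_cancel h0 htop).symm

/-- Under positivity, dividing by the conditional density of `m` given `x` is multiplying by
`p(x) / p(x, m)`. -/
theorem ae_condPDF_mul_eq_one (hx : Measurable x) (hm : Measurable m)
    (hac : P.map (fun ω => (x ω, m ω)) ≪ μX.prod μM)
    (hpos : ∀ᵐ z ∂μX.prod μM, 0 < pdf x P μX z.1 → 0 < pdf m P μM z.2 →
      0 < pdf (fun ω => (x ω, m ω)) P (μX.prod μM) z) :
    ∀ᵐ m₀ ∂μM, pdf m P μM m₀ ≠ 0 → ∀ᵐ x₀ ∂P.map x,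
      condPDF P m μM x μX m₀ x₀ *
        (pdf x P μX x₀ / pdf (fun ω => (x ω, m ω)) P (μX.prod μM) (x₀, m₀)) = 1 := by
  have hswap : Measure.QuasiMeasurePreserving Prod.swap (μM.prod μX) (μX.prod μM) :=
    Measure.measurePreserving_swap.quasiMeasurePreserving
  have hacx := map_absolutelyContinuous_of_prod_snd hm hx
    (map_prod_swap_absolutelyContinuous hx hm hac)
  have hall := Measure.ae_ae_of_ae_prod (((hswap.ae hpos).and (hswap.ae
    (pdf_ne_top (fun ω => (x ω, m ω)) P (μX.prod μM)))).and (pdf_prod_swap_ae_eq hx hm hac))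
  filter_upwards [hall] with m₀ h hm₀
  -- Almost everywhere for the law of `x` means for almost every `x₀` with p(x₀) ≠ 0. There
  -- positivity gives p(x₀, m₀) ≠ 0, and all factors cancel.
  rw [← map_eq_withDensity_pdf' hacx, ae_withDensity_iff (measurable_pdf _ P _)]
  filter_upwards [h, pdf_ne_top x P μX] with x₀ h htop h0
  obtain ⟨⟨hp, hp2⟩, hq⟩ := h
  have hp := hp (pos_iff_ne_zero.mpr h0) (pos_iff_ne_zero.mpr hm₀)
  simp only [Prod.swap_prod_mk] at hp hp2 hq
  rw [condPDF, hq, div_eq_mul_inv, div_eq_mul_inv, mul_mul_mul_comm, mul_comm (pdf x P μX x₀)⁻¹,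
    mul_mul_mul_comm, ENNReal.mul_inv_cancel h0 htop, ENNReal.mul_inv_cancel hp.ne' hp2, one_mul]

/-- The law of `ψ m₀ ζ`, by adjustment for `x`. -/
theorem ae_map_eq_withDensity_adjustment [MeasurableSpace.CountablyGenerated 𝕄]
    [MeasurableSpace.CountablyGenerated 𝕐] (hξ : Measurable ξ) (hζ : Measurable ζ)
    (hind : IndepFun ξ ζ P) (hφ : Measurable (Function.uncurry φ)) (hχ : Measurable χ)
    (hψ : Measurable (Function.uncurry ψ)) (hx : x = fun ω => χ (ζ ω))
    (hm : m = fun ω => φ (x ω) (ξ ω)) (hy : y = fun ω => ψ (m ω) (ζ ω))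
    (hdens : P.map (fun ω => (y ω, x ω, m ω)) ≪ μY.prod (μX.prod μM))
    (hpos : ∀ᵐ z ∂μX.prod μM, 0 < pdf x P μX z.1 → 0 < pdf m P μM z.2 →
      0 < pdf (fun ω => (x ω, m ω)) P (μX.prod μM) z) :
    ∀ᵐ m₀ ∂μM, pdf m P μM m₀ ≠ 0 → (P.map ζ).map (ψ m₀) = μY.withDensity fun y₀ =>
      ∫⁻ x', condPDF P y μY (fun ω => (x ω, m ω)) (μX.prod μM) y₀ (x', m₀) *
        pdf x P μX x' ∂μX := by
  have hxm : Measurable x := by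
    rw [hx]
    exact hχ.comp hζ
  have hmm : Measurable m := by
    rw [hm]
    exact hφ.comp (hxm.prodMk hξ)
  have hym : Measurable y := by
    rw [hy]
    exact hψ.comp (hmm.prodMk hζ)
  have := Measure.isProbabilityMeasure_map (μ := P) hξ.aemeasurable
  have := Measure.isProbabilityMeasure_map (μ := P) hζ.aemeasurable
  have hφr : ∀ x₀, Measurable (φ x₀) := fun x₀ => hφ.of_uncurry_left
  have hψr : ∀ m₀, Measurable (ψ m₀) := fun m₀ => hψ.of_uncurry_left
  have hac := map_absolutelyContinuous_of_prod_snd hym (hxm.prodMk hmm) hdens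
  have hac' := map_prod_swap_absolutelyContinuous hxm hmm hac
  set D : Set 𝕄 := {m₀ | pdf m P μM m₀ ≠ 0}
  have hD : MeasurableSet D := (measurable_pdf m P μM) (measurableSet_singleton 0).compl
  set p3 := pdf (fun ω => (y ω, x ω, m ω)) P (μY.prod (μX.prod μM))
  set p2 := pdf (fun ω => (x ω, m ω)) P (μX.prod μM)
  set K : 𝕄 → 𝕏 → ℝ≥0∞ := fun m₀ x₀ => condPDF P m μM x μX m₀ x₀
  have hp3 : Measurable p3 := measurable_pdf _ P _
  have hp2 : Measurable p2 := measurable_pdf _ P _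
  have hpx : Measurable (pdf x P μX) := measurable_pdf _ P _
  have hK : Measurable (Function.uncurry K) := measurable_condPDF P m μM x μX
  -- Inverse probability weight: it turns p(m | x) into 1 and p(y, x, m) into p(y | x, m) p(x).
  set c : 𝕏 → 𝕄 → ℝ≥0∞ := fun x₀ m₀ => pdf x P μX x₀ / p2 (x₀, m₀)
  have hc : Measurable (Function.uncurry c) := (hpx.comp measurable_fst).div hp2
  have hA : Measurable fun z : 𝕄 × 𝕐 × 𝕏 =>
      condPDF P y μY (fun ω => (x ω, m ω)) (μX.prod μM) z.2.1 (z.2.2, z.1) * pdf x P μX z.2.2 :=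
    ((measurable_condPDF P y μY (fun ω => (x ω, m ω)) (μX.prod μM)).comp (by fun_prop :
      Measurable fun z : 𝕄 × 𝕐 × 𝕏 => (z.2.1, (z.2.2, z.1)))).mul (hpx.comp (by fun_prop))
  have hA' : Measurable fun z : 𝕄 × 𝕐 => ∫⁻ x',
      condPDF P y μY (fun ω => (x ω, m ω)) (μX.prod μM) z.2 (x', z.1) * pdf x P μX x' ∂μX :=
    Measurable.lintegral_prod_right' (f := fun z : (𝕄 × 𝕐) × 𝕏 =>
      condPDF P y μY (fun ω => (x ω, m ω)) (μX.prod μM) z.1.2 (z.2, z.1.1) * pdf x P μX z.2)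
      (hA.comp (by fun_prop : Measurable fun z : (𝕄 × 𝕐) × 𝕏 => (z.1.1, z.1.2, z.2)))
  suffices ∀ᵐ m₀ ∂μM.restrict D, (P.map ζ).map (ψ m₀) = μY.withDensity fun y₀ =>
      ∫⁻ x', condPDF P y μY (fun ω => (x ω, m ω)) (μX.prod μM) y₀ (x', m₀) *
        pdf x P μX x' ∂μX from (ae_restrict_iff' hD).mp this
  refine ae_measure_eq_of_forall_ae_apply_eq fun t ht => ?_
  simp_rw [withDensity_apply _ ht]
  have hν : Measurable fun m₀ => (P.map ζ).map (ψ m₀) t := by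
    simp_rw [Measure.map_apply (hψr _) ht]
    exact measurable_measure_prodMk_left (hψ ht)
  refine ae_eq_of_forall_setLIntegral_eq_of_sigmaFinite hν
    (Measurable.lintegral_prod_right' hA') fun s hs _ => ?_
  rw [Measure.restrict_restrict hs]
  set s' := s ∩ D
  have hs' : MeasurableSet s' := hs.inter hD
  have hi : Measurable (s'.indicator (1 : 𝕄 → ℝ≥0∞)) := measurable_one.indicator hs'
  have hj : Measurable (t.indicator (1 : 𝕐 → ℝ≥0∞)) := measurable_one.indicator ht
  have hone := ae_condPDF_mul_eq_one hxm hmm hac hpos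
  have hmapx : P.map x = (P.map ζ).map χ := by
    rw [Measure.map_map hχ hζ, hx]
    rfl
  -- both sides are the expectation of `1_s'(m) 1_t(y) p(x) / p(x, m)`
  trans ∫⁻ ω, s'.indicator 1 (m ω) * (t.indicator 1 (y ω) * c (x ω) (m ω)) ∂P
  · have hH : Measurable fun z : 𝕄 × Z =>
        s'.indicator 1 z.1 * (t.indicator 1 (ψ z.1 z.2) * c (χ z.2) z.1) :=
      (hi.comp measurable_fst).mul ((hj.comp hψ).mul (hc.comp
        ((hχ.comp measurable_snd).prodMk measurable_fst)))
    have h := hind.lintegral_comp_prod hξ hζ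
      (h := fun e z => s'.indicator 1 (φ (χ z) e) *
        (t.indicator 1 (ψ (φ (χ z) e) z) * c (χ z) (φ (χ z) e)))
      (hH.comp ((hφ.comp ((hχ.comp measurable_snd).prodMk measurable_fst)).prodMk measurable_snd))
    have hω : ∀ ω, s'.indicator 1 (m ω) * (t.indicator 1 (y ω) * c (x ω) (m ω)) =
        s'.indicator 1 (φ (χ (ζ ω)) (ξ ω)) * (t.indicator 1 (ψ (φ (χ (ζ ω)) (ξ ω)) (ζ ω)) *
          c (χ (ζ ω)) (φ (χ (ζ ω)) (ξ ω))) := fun ω => by simp only [hy, hm, hx]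
    rw [lintegral_congr hω, h]
    -- For fixed `ζ = z` the mediator has density p(m | χ z). After exchanging the integrals, this
    -- density cancels the weight, and the law of `ψ m₀ ζ` remains.
    trans ∫⁻ z, ∫⁻ m₀, K m₀ (χ z) * (s'.indicator 1 m₀ *
        (t.indicator 1 (ψ m₀ z) * c (χ z) m₀)) ∂μM ∂P.map ζ
    · rw [lintegral_lintegral_swap]
      · rw [← lintegral_indicator hs']
        refine lintegral_congr_ae ?_
        filter_upwards [hone] with m₀ hm₀
        by_cases hmem : m₀ ∈ s'
        · rw [Set.indicator_of_mem hmem, ← lintegral_indicator_one ht,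
            lintegral_map hj (hψr m₀)]
          refine lintegral_congr_ae ?_
          have := hm₀ hmem.2
          rw [hmapx] at this
          filter_upwards [ae_of_ae_map hχ.aemeasurable this] with z hz
          rw [Set.indicator_of_mem hmem, Pi.one_apply, one_mul, mul_left_comm, hz, mul_one]
        · simp [hmem]
      · exact ((hK.comp (measurable_snd.prodMk (hχ.comp measurable_fst))).mul
          (hH.comp measurable_swap)).aemeasurable
    · refine lintegral_congr_ae ?_
      have hz := ae_map_eq_withDensity_condPDF hξ hxm
        (by rw [hx]; exact hind.comp measurable_id hχ) hφ hm hac'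
      rw [hmapx] at hz
      filter_upwards [ae_of_ae_map hχ.aemeasurable hz] with z hz
      have hHz : Measurable fun m₀ => s'.indicator 1 m₀ *
          (t.indicator 1 (ψ m₀ z) * c (χ z) m₀) :=
        hH.comp (measurable_id.prodMk measurable_const)
      rw [← lintegral_map hHz (hφr (χ z)), hz, lintegral_withDensity_eq_lintegral_mul _
        (measurable_condPDF_left P m μM x μX (χ z)) hHz]
      rfl
  · have hH : Measurable fun z : 𝕐 × 𝕏 × 𝕄 =>
        s'.indicator 1 z.2.2 * (t.indicator 1 z.1 * c z.2.1 z.2.2) :=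
      (hi.comp (by fun_prop)).mul ((hj.comp measurable_fst).mul (hc.comp measurable_snd))
    have hpH : Measurable fun z : 𝕐 × 𝕏 × 𝕄 =>
        p3 z * (s'.indicator 1 z.2.2 * (t.indicator 1 z.1 * c z.2.1 z.2.2)) := hp3.mul hH
    -- The same expectation, computed from the joint density of `(y, x, m)`.
    rw [← lintegral_map hH (hym.prodMk (hxm.prodMk hmm)), ← map_eq_withDensity_pdf' hdens,
      lintegral_withDensity_eq_lintegral_mul _ (measurable_pdf _ P _) hH]
    refine Eq.trans (lintegral_prod _ hpH.aemeasurable) ?_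
    have h1 : ∀ y₀, ∫⁻ w, p3 (y₀, w) * (s'.indicator 1 w.2 * (t.indicator 1 y₀ * c w.1 w.2))
        ∂μX.prod μM = ∫⁻ m₀, ∫⁻ x₀, p3 (y₀, x₀, m₀) * (s'.indicator 1 m₀ *
          (t.indicator 1 y₀ * c x₀ m₀)) ∂μX ∂μM := fun y₀ =>
      lintegral_prod_symm' _ (hpH.comp (measurable_const.prodMk measurable_id))
    refine (lintegral_congr h1).trans ?_
    rw [lintegral_lintegral_swap]
    · rw [← lintegral_indicator hs']
      refine lintegral_congr fun m₀ => ?_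
      by_cases hmem : m₀ ∈ s'
      · simp only [Set.indicator_of_mem hmem]
        rw [← lintegral_indicator ht]
        refine lintegral_congr fun y₀ => ?_
        by_cases hyt : y₀ ∈ t
        · simp only [Set.indicator_of_mem hyt]
          refine lintegral_congr fun x₀ => ?_
          simp only [Pi.one_apply, one_mul, c,
            condPDF, div_eq_mul_inv]
          rw [mul_assoc, mul_comm (pdf x P μX x₀)]
        · simp [hyt]
      · simp [hmem]
    · exact (Measurable.lintegral_prod_right' (f := fun z : (𝕐 × 𝕄) × 𝕏 =>
        p3 (z.1.1, z.2, z.1.2) * (s'.indicator 1 z.1.2 * (t.indicator 1 z.1.1 * c z.2 z.1.2)))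
        (hpH.comp (by fun_prop : Measurable fun z : (𝕐 × 𝕄) × 𝕏 =>
          (z.1.1, z.2, z.1.2)))).aemeasurable

/-- The front-door formula for `x = χ ζ`, `m = φ x ξ`, `y = ψ m ζ` with `ξ` and `ζ` independent. -/
theorem ae_map_eq_withDensity_frontDoor [MeasurableSpace.CountablyGenerated 𝕄]
    [MeasurableSpace.CountablyGenerated 𝕐] (hξ : Measurable ξ) (hζ : Measurable ζ)
    (hind : IndepFun ξ ζ P) (hφ : Measurable (Function.uncurry φ)) (hχ : Measurable χ)
    (hψ : Measurable (Function.uncurry ψ)) (hx : x = fun ω => χ (ζ ω))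
    (hm : m = fun ω => φ (x ω) (ξ ω)) (hy : y = fun ω => ψ (m ω) (ζ ω))
    (hdens : P.map (fun ω => (y ω, x ω, m ω)) ≪ μY.prod (μX.prod μM))
    (hpos : ∀ᵐ z ∂μX.prod μM, 0 < pdf x P μX z.1 → 0 < pdf m P μM z.2 →
      0 < pdf (fun ω => (x ω, m ω)) P (μX.prod μM) z) :
    ∀ᵐ x₀ ∂P.map x, P.map (fun ω => ψ (φ x₀ (ξ ω)) (ζ ω)) = μY.withDensity fun y₀ =>
      ∫⁻ x', ∫⁻ m₀, condPDF P y μY (fun ω => (x ω, m ω)) (μX.prod μM) y₀ (x', m₀) *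
        condPDF P m μM x μX m₀ x₀ * pdf x P μX x' ∂μM ∂μX := by
  have hadj := ae_map_eq_withDensity_adjustment hξ hζ hind hφ hχ hψ hx hm hy hdens hpos
  have hxm : Measurable x := by
    rw [hx]
    exact hχ.comp hζ
  have hmm : Measurable m := by
    rw [hm]
    exact hφ.comp (hxm.prodMk hξ)
  have hym : Measurable y := by
    rw [hy]
    exact hψ.comp (hmm.prodMk hζ)
  have := Measure.isProbabilityMeasure_map (μ := P) hξ.aemeasurable
  have := Measure.isProbabilityMeasure_map (μ := P) hζ.aemeasurable
  have hφr : ∀ x₀, Measurable (φ x₀) := fun x₀ => hφ.of_uncurry_left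
  have hψr : ∀ m₀, Measurable (ψ m₀) := fun m₀ => hψ.of_uncurry_left
  have hac := map_absolutelyContinuous_of_prod_snd hym (hxm.prodMk hmm) hdens
  have hac' := map_prod_swap_absolutelyContinuous hxm hmm hac
  have hacx := map_absolutelyContinuous_of_prod_snd hmm hxm hac'
  have hker := ae_map_eq_withDensity_condPDF hξ hxm
    (by rw [hx]; exact hind.comp measurable_id hχ) hφ hm hac'
  -- The law of `ψ m₀ ζ` is known only where p(m₀) ≠ 0; this shows that p(m | x) puts no mass
  -- elsewhere.
  have hzero : ∀ᵐ z ∂μX.prod μM, condPDF P m μM x μX z.2 z.1 ≠ 0 → pdf m P μM z.2 ≠ 0 := by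
    have hset : MeasurableSet {z : 𝕄 × 𝕏 |
        condPDF P m μM x μX z.1 z.2 ≠ 0 → pdf m P μM z.1 ≠ 0} := by
      have h1 := (measurable_condPDF P m μM x μX) (measurableSet_singleton 0)
      have h2 := ((measurable_pdf m P μM).comp measurable_fst :
        Measurable fun z : 𝕄 × 𝕏 => pdf m P μM z.1) (measurableSet_singleton 0)
      convert h1.union h2.compl using 1
      ext z
      simp only [Set.mem_ofPred_eq, Set.mem_union, Set.mem_preimage, Set.mem_compl_iff,
        Set.mem_singleton_iff]
      tauto
    have h : ∀ᵐ z ∂μM.prod μX, condPDF P m μM x μX z.1 z.2 ≠ 0 → pdf m P μM z.1 ≠ 0 := by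
      refine (Measure.ae_prod_iff_ae_ae hset).mpr ?_
      filter_upwards [pdf_prod_eq_zero_of_pdf_snd_eq_zero hxm hmm hac,
        Measure.ae_ae_of_ae_prod (pdf_prod_swap_ae_eq hxm hmm hac)] with m₀ h1 h2
      by_cases h0 : pdf m P μM m₀ = 0
      · filter_upwards [h1 h0, h2] with x₀ h1 h2 hne
        refine absurd ?_ hne
        rw [condPDF, h2, Prod.swap_prod_mk, h1, ENNReal.zero_div]
      · exact Filter.Eventually.of_forall fun _ _ => h0
    exact (Measure.measurePreserving_swap (μ := μX) (ν := μM)).quasiMeasurePreserving.ae h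
  filter_upwards [hker, hacx.ae_le (Measure.ae_ae_of_ae_prod hzero)] with x₀ hker hzero
  have hK := measurable_condPDF P m μM x μX
  have hKx : Measurable fun m₀ => condPDF P m μM x μX m₀ x₀ :=
    hK.comp (measurable_id.prodMk measurable_const)
  have hC := measurable_condPDF P y μY (fun ω => (x ω, m ω)) (μX.prod μM)
  have hpx : Measurable (pdf x P μX) := measurable_pdf _ P _
  ext t ht
  have hj : Measurable (t.indicator (1 : 𝕐 → ℝ≥0∞)) := measurable_one.indicator ht
  have hν : Measurable fun m₀ => (P.map ζ).map (ψ m₀) t := by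
    simp_rw [Measure.map_apply (hψr _) ht]
    exact measurable_measure_prodMk_left (hψ ht)
  have hY : Measurable fun ω => ψ (φ x₀ (ξ ω)) (ζ ω) := hψ.comp (((hφr x₀).comp hξ).prodMk hζ)
  have hmeas : Measurable fun z : (𝕄 × 𝕐) × 𝕏 =>
      condPDF P y μY (fun ω => (x ω, m ω)) (μX.prod μM) z.1.2 (z.2, z.1.1) *
        condPDF P m μM x μX z.1.1 x₀ * pdf x P μX z.2 :=
    ((hC.comp (by fun_prop : Measurable fun z : (𝕄 × 𝕐) × 𝕏 => (z.1.2, (z.2, z.1.1)))).mul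
      (hKx.comp (by fun_prop))).mul (hpx.comp measurable_snd)
  calc P.map (fun ω => ψ (φ x₀ (ξ ω)) (ζ ω)) t
      = ∫⁻ ω, t.indicator 1 (ψ (φ x₀ (ξ ω)) (ζ ω)) ∂P := by
        rw [← lintegral_indicator_one ht, lintegral_map hj hY]
    _ = ∫⁻ e, ∫⁻ z, t.indicator 1 (ψ (φ x₀ e) z) ∂P.map ζ ∂P.map ξ :=
        hind.symm.lintegral_comp_prod hζ hξ (h := fun z e => t.indicator 1 (ψ (φ x₀ e) z))
          (hj.comp (hψ.comp (((hφr x₀).comp measurable_snd).prodMk measurable_fst)))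
    _ = ∫⁻ e, (P.map ζ).map (ψ (φ x₀ e)) t ∂P.map ξ := by
        refine lintegral_congr fun e => ?_
        rw [← lintegral_indicator_one ht, lintegral_map hj (hψr _)]
    _ = ∫⁻ m₀, (P.map ζ).map (ψ m₀) t ∂(P.map ξ).map (φ x₀) := (lintegral_map hν (hφr x₀)).symm
    _ = ∫⁻ m₀, condPDF P m μM x μX m₀ x₀ * (P.map ζ).map (ψ m₀) t ∂μM := by
        rw [hker, lintegral_withDensity_eq_lintegral_mul _ hKx hν]
        rfl
    _ = ∫⁻ m₀, ∫⁻ y₀ in t, ∫⁻ x', condPDF P y μY (fun ω => (x ω, m ω)) (μX.prod μM) y₀ (x', m₀) *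
          condPDF P m μM x μX m₀ x₀ * pdf x P μX x' ∂μX ∂μY ∂μM := by
        refine lintegral_congr_ae ?_
        filter_upwards [hzero, hadj] with m₀ hzero hadj
        -- Both sides vanish with p(m₀ | x₀); otherwise p(m₀) ≠ 0 and the adjustment applies.
        by_cases h0 : condPDF P m μM x μX m₀ x₀ = 0
        · simp [h0]
        · have hCm : Measurable fun z : 𝕐 × 𝕏 =>
              condPDF P y μY (fun ω => (x ω, m ω)) (μX.prod μM) z.1 (z.2, m₀) * pdf x P μX z.2 :=
            (hC.comp (by fun_prop : Measurable fun z : 𝕐 × 𝕏 => (z.1, (z.2, m₀)))).mul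
              (hpx.comp measurable_snd)
          rw [hadj (hzero h0), withDensity_apply _ ht,
            ← lintegral_const_mul _ hCm.lintegral_prod_right']
          refine lintegral_congr fun y₀ => ?_
          rw [← lintegral_const_mul _ (by exact hCm.comp (measurable_const.prodMk measurable_id) :
            Measurable fun x' =>
              condPDF P y μY (fun ω => (x ω, m ω)) (μX.prod μM) y₀ (x', m₀) * pdf x P μX x')]
          refine lintegral_congr fun x' => ?_
          ring
    _ = ∫⁻ y₀ in t, ∫⁻ m₀, ∫⁻ x', condPDF P y μY (fun ω => (x ω, m ω)) (μX.prod μM) y₀ (x', m₀) *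
          condPDF P m μM x μX m₀ x₀ * pdf x P μX x' ∂μX ∂μM ∂μY :=
        lintegral_lintegral_swap hmeas.lintegral_prod_right'.aemeasurable
    _ = ∫⁻ y₀ in t, ∫⁻ x', ∫⁻ m₀, condPDF P y μY (fun ω => (x ω, m ω)) (μX.prod μM) y₀ (x', m₀) *
          condPDF P m μM x μX m₀ x₀ * pdf x P μX x' ∂μM ∂μX ∂μY := by
        refine lintegral_congr fun y₀ => lintegral_lintegral_swap ?_
        exact (hmeas.comp (by fun_prop : Measurable fun z : 𝕄 × 𝕏 => ((z.1, y₀), z.2))).aemeasurable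
    _ = _ := (withDensity_apply _ ht).symm

end FrontDoor

/-! ### Application to the structural causal model -/

theorem corollary1 {V : Type*} [Fintype V] [DecidableEq V] (G : ADMG V) (X Y : V)
    (Xs Ys Ms : Finset V) (hT : G.IsFDRTriple X Y Xs Ys Ms)
    {𝒳 E : V → Type*} [∀ v, MeasurableSpace (𝒳 v)] [∀ v, MeasurableSpace (E v)]
    [∀ v, MeasurableSpace.CountablyGenerated (𝒳 v)]
    (𝓜 : SCM G 𝒳 E) (μ : ∀ v, Measure (𝒳 v)) [∀ v, SigmaFinite (μ v)]
    -- the observational distribution of `(Ys, Xs, Ms)` has a density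
    (hdens : 𝓜.noise.map (fun u => (𝓜.obs Ys u, 𝓜.obs Xs u, 𝓜.obs Ms u)) ≪
      (refMeasure μ Ys).prod ((refMeasure μ Xs).prod (refMeasure μ Ms)))
    -- positivity: `p(x, m) > 0` wherever `p(x) > 0` and `p(m) > 0`
    (hpos : ∀ᵐ z ∂(refMeasure μ Xs).prod (refMeasure μ Ms),
      0 < pdf (𝓜.obs Xs) 𝓜.noise (refMeasure μ Xs) z.1 →
      0 < pdf (𝓜.obs Ms) 𝓜.noise (refMeasure μ Ms) z.2 →
      0 < pdf (fun u => (𝓜.obs Xs u, 𝓜.obs Ms u)) 𝓜.noise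
        ((refMeasure μ Xs).prod (refMeasure μ Ms)) z) :
    -- for almost every `x` with `p(x) > 0`, `do(Xs = x)` gives `Ys` the density of the formula
    ∀ᵐ x ∂𝓜.noise.map (𝓜.obs Xs),
      𝓜.doLaw Xs x Ys = (refMeasure μ Ys).withDensity (fdrAdjustment 𝓜 μ Xs Ys Ms x) := by
  classical
  have hM := hT.mediator
  have hMX := ADMG.disjoint_cause_mediator hM
  have hYM := ADMG.disjoint_effect_mediator hM
  have := 𝓜.isProbabilityMeasure_noise
  have : ∀ A : Finset V, SigmaFinite (refMeasure μ A) := fun A =>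
    inferInstanceAs (SigmaFinite (Measure.pi fun v : A => μ v))
  have : ∀ A : Finset V, MeasurableSpace.CountablyGenerated (∀ v : A, 𝒳 v) := fun A =>
    MeasurableSpace.CountablyGenerated.pi
  -- Arbitrary default errors: the responses below read only the errors in `A` or only those in `B`.
  obtain ⟨u₀⟩ := nonempty_of_isProbabilityMeasure 𝓜.noise
  -- the errors behind the response of the mediators, and those behind causes and effect
  set A : Finset V := Finset.univ.filter fun v => v ∈ (G.induce (Xs : Set V)ᶜ).An Ms
  set B : Finset V := Finset.univ.filter fun v =>
    v ∈ G.An Xs ∪ (G.induce (Ms : Set V)ᶜ).An Ys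
  have hsep : ∀ v ∈ A, ∀ w ∈ B, v ≠ w ∧ ¬ G.bidir v w := by
    intro v hv w hw
    have hv := (Finset.mem_filter.mp hv).2
    rcases (Finset.mem_filter.mp hw).2 with hw | hw
    · exact ADMG.mediator_sep_cause hM hv hw
    · exact ADMG.mediator_sep_effect hM hv hw
  have hind := 𝓜.indep_noise A B
    (Finset.disjoint_left.mpr fun v hv hv' => (hsep v hv v hv').1 rfl)
    fun v hv w hw => (hsep v hv w hw).2
  have hext : ∀ (C : Finset V) (u : ∀ v, E v), ∀ v ∈ C,
      u v = C.extendBy u₀ (C.restrict u) v := fun C u v hv => by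
    simp [Finset.extendBy, hv]
  have hMs : ∀ x u, Ms.restrict (𝓜.response Xs x u) =
      Ms.restrict (𝓜.response Xs x (A.extendBy u₀ (A.restrict u))) := fun x u => by
    funext v
    exact 𝓜.response_eq_of_eqOn_An_induce hMX x
      (fun w hw => hext A u w (Finset.mem_filter.mpr ⟨Finset.mem_univ w, hw⟩)) v.2
  have hXs : ∀ u, 𝓜.obs Xs u = 𝓜.obs Xs (B.extendBy u₀ (B.restrict u)) := fun u =>
    𝓜.obs_eq_of_eqOn_An
      fun w hw => hext B u w (Finset.mem_filter.mpr ⟨Finset.mem_univ w, .inl hw⟩)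
  have hYs : ∀ x u, Ys.restrict (𝓜.response Xs x u) =
      Ys.restrict (𝓜.response Ms (Ms.restrict (𝓜.response Xs x u))
        (B.extendBy u₀ (B.restrict u))) := fun x u => by
    funext v
    refine (𝓜.response_eq_response_mediator hYM
      (fun w hw => ADMG.notMem_cause_of_mem_An_effect hM hw) x u v.2).trans ?_
    exact 𝓜.response_eq_of_eqOn_An_induce hYM _
      (fun w hw => hext B u w (Finset.mem_filter.mpr ⟨Finset.mem_univ w, .inr hw⟩)) v.2
  -- By consistency, the observed values are the responses to the observed causes, so the same `φ`
  -- and `ψ` describe both the observational and the interventional regime.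
  have hobs : ∀ (C : Finset V) u, 𝓜.obs C u = C.restrict (𝓜.response Xs (𝓜.obs Xs u) u) :=
    fun C u => by
      funext v
      exact (𝓜.response_obs Xs u v).symm
  have hmeas : ∀ (S C D : Finset V), Measurable fun z : (∀ v : S, 𝒳 v) × (∀ v : D, E v) =>
      C.restrict (𝓜.response S z.1 (D.extendBy u₀ z.2)) := fun S C D =>
    (Finset.measurable_restrict C).comp ((𝓜.measurable_response S).comp
      (measurable_fst.prodMk ((Finset.measurable_extendBy D u₀).comp measurable_snd)))
  have key := ae_map_eq_withDensity_frontDoor (P := 𝓜.noise)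
    (φ := fun x e => Ms.restrict (𝓜.response Xs x (A.extendBy u₀ e)))
    (χ := fun e => 𝓜.obs Xs (B.extendBy u₀ e))
    (ψ := fun m e => Ys.restrict (𝓜.response Ms m (B.extendBy u₀ e)))
    (Finset.measurable_restrict A) (Finset.measurable_restrict B) hind (hmeas Xs Ms A)
    ((𝓜.measurable_obs Xs).comp (Finset.measurable_extendBy B u₀)) (hmeas Ms Ys B)
    (funext hXs) (funext fun u => (hobs Ms u).trans (hMs _ u))
    (funext fun u => ((hobs Ys u).trans (hYs _ u)).trans (by rw [← hobs Ms u])) hdens hpos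
  filter_upwards [key] with x hx
  refine Eq.trans ?_ hx
  rw [SCM.doLaw]
  congr 1
  funext u
  rw [hYs, hMs]
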